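/- Let $X$ be a compact Kähler manifold, $L$ an ample holomorphic line bundle on $X$, and write $kL=L^{\otimes k}$. A hermitian metric $h=e^{-\phi}$ on $L$ is denoted by $\phi$; for a local holomorphic frame $f$ of $L$ its weight $\phi_f$ is defined by $|f|_h^2=e^{-\phi_f}$. Let $\mathcal H(L)$ be the set of smooth hermitian metrics $\phi$ on $L$ that are strictly positive, i.e. all weights $\phi_f$ are smooth and strictly plurisubharmonic. A singular metric $\psi$ is given in the same way by local weights $\psi_f$ with values in $[-\infty,\infty]$, with $\psi_{f'}=\psi_f+\log|g|^2$ when $f=gf'$ (the metric $\psi\equiv-\infty$ is allowed). For two singular metrics write $\psi\sim\phi$ (same singularity type) if there is a constant $C$ with $\psi\le\phi+C$ and $\phi\le\psi+C$ on $X$. Let $\mathcal F$ be a filtration of the section ring $\bigoplus_{k\ge 0}H^0(kL)$: for every $k\in\mathbb N$ a family $\mathcal F_tH^0(kL)$, $t\in\mathbb R$, of subspaces of $H^0(kL)$ that is decreasing and left-continuous in $t$. Assume that $\mathcal F$ is multiplicative, $(\mathcal F_tH^0(kL))(\mathcal F_sH^0(mL))\subseteq\mathcal F_{t+s}H^0((k+m)L)$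 for all $k,m\in\mathbb N$ and $s,t\in\mathbb R$, and linearly bounded: there is a constant $C$ such that $\mathcal F_{-kC}H^0(kL)=H^0(kL)$ and $\mathcal F_{kC}H^0(kL)=\{0\}$ for all $k\ge 1$. Fix a smooth volume form $dV$ on $X$ of total mass $1$. For $\phi\in\mathcal H(L)$, $\lambda\in\mathbb R$ and $k\ge1$, let $\{s_{i,\lambda}\}_i$ be an orthonormal basis of $\mathcal F_{k\lambda}H^0(kL)$ for the scalar product $(s,t)_{k\phi}=\int_X s\,\overline t\,e^{-k\phi}\,dV$, and let $$\phi_{k,\lambda}=\frac1k\log\Bigl(\sum_i|s_{i,\lambda}|^2\Bigr),$$ the singular metric whose weight in a frame $f$ is $\frac1k\log\sum_i|h_i|^2$, where $s_{i,\lambda}=h_if^{\otimes k}$ and $\log 0=-\infty$. Define $$\phi^{\mathcal F}_\lambda=\Bigl(\limsup_{k\to\infty}\phi_{k,\lambda}\Bigr)^*,$$ where $^*$ denotes the upper semicontinuous regularization (of the local weights). Then for any two $\phi,\psi\in\mathcal H(L)$ and any $\lambda\in\mathbb R$, $$\phi^{\mathcal F}_\lambda\sim\psi^{\mathcal F}_\lambda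 .$$ -/

import Mathlib

open Bundle Filter Topology MeasureTheory Set
open scoped Manifold ContDiff TensorProduct

noncomputable section

/-- The model space `ℂⁿ`. -/
abbrev Cn (n : ℕ) : Type := EuclideanSpace ℂ (Fin n)

section LineBundles

variable {X : Type*} [TopologicalSpace X]
  {L : X → Type*} [∀ x, AddCommGroup (L x)] [∀ x, Module ℂ (L x)] [∀ x, TopologicalSpace (L x)]
  [TopologicalSpace (TotalSpace ℂ L)] [FiberBundle ℂ L] [VectorBundle ℂ ℂ L]

/-! ### Local frames and tensor powers

A member `e` of the trivialization atlas of `L` is the same thing as a local frame of `L` over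
`e.baseSet`. -/

/-- The local frame of `L` given by a trivialization `e`: the section over `e.baseSet` that is
equal to `1` in the trivialization. -/
def localFrame (e : Trivialization ℂ (π ℂ L)) (x : X) : L x := e.symm x 1

/-- The transition function `g` between two frames: `localFrame e = g • localFrame e'` over
`e.baseSet ∩ e'.baseSet`. -/
def transition (e e' : Trivialization ℂ (π ℂ L)) [MemTrivializationAtlas e'] (x : X) : ℂ :=
  e'.linearMapAt ℂ x (localFrame e x)

/-- Coordinates on the fibre of `kL = L^{⊗k}` with respect to the frame `f^{⊗k}`, where `f` is the
local frame given by `e`: the linear map with `v₁ ⊗ ⋯ ⊗ vₖ ↦ ∏ e(vᵢ)`. -/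
def powCoord (e : Trivialization ℂ (π ℂ L)) [MemTrivializationAtlas e] (k : ℕ) (x : X) :
    (⨂[ℂ]^k (L x)) →ₗ[ℂ] ℂ :=
  PiTensorProduct.lift
    ((MultilinearMap.mkPiAlgebra ℂ (Fin k) ℂ).compLinearMap fun _ => e.linearMapAt ℂ x)

variable (L) in
/-- All (set-theoretic) sections of `kL = L^{⊗k}`. -/
abbrev PowSection (k : ℕ) := ∀ x : X, ⨂[ℂ]^k (L x)

/-- The product `s ⊗ t` of a section of `kL` and a section of `mL`, a section of `(k+m)L`. -/
def PowSection.mul {k m : ℕ} (s : PowSection L k) (t : PowSection L m) : PowSection L (k + m) :=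
  fun x => TensorPower.mulEquiv (s x ⊗ₜ[ℂ] t x)

theorem linearMapAt_eq_transition_mul (e e' : Trivialization ℂ (π ℂ L)) [MemTrivializationAtlas e]
    [MemTrivializationAtlas e'] {x : X} (hx : x ∈ e.baseSet) (v : L x) :
    e'.linearMapAt ℂ x v = transition e e' x * e.linearMapAt ℂ x v := by
  have h : v = (e.linearMapAt ℂ x v) • localFrame e x := by
    have h1 : (e.symmₗ ℂ x) (e.linearMapAt ℂ x v) = v := e.symmₗ_linearMapAt hx v
    have h2 : (e.symmₗ ℂ x) ((e.linearMapAt ℂ x v) • (1 : ℂ)) =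
        (e.linearMapAt ℂ x v) • (e.symmₗ ℂ x) 1 := map_smul _ _ _
    rw [smul_eq_mul, mul_one, h1, e.symmₗ_apply hx] at h2
    exact h2
  conv_lhs => rw [h]
  rw [map_smul, smul_eq_mul, mul_comm]
  rfl

theorem powCoord_eq_transition_mul (e e' : Trivialization ℂ (π ℂ L)) [MemTrivializationAtlas e]
    [MemTrivializationAtlas e'] (k : ℕ) {x : X} (hx : x ∈ e.baseSet) (t : ⨂[ℂ]^k (L x)) :
    powCoord e' k x t = transition e e' x ^ k * powCoord e k x t := by
  have h : powCoord e' k x = (transition e e' x ^ k) • powCoord e k x := by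
    apply PiTensorProduct.ext
    ext v
    simp [powCoord, linearMapAt_eq_transition_mul e e' hx, Finset.prod_mul_distrib]
  rw [h]
  rfl

theorem transition_ne_zero (e e' : Trivialization ℂ (π ℂ L)) [MemTrivializationAtlas e]
    [MemTrivializationAtlas e'] {x : X} (hx : x ∈ e.baseSet) (hx' : x ∈ e'.baseSet) :
    transition e e' x ≠ 0 := by
  intro h0
  have h1 := linearMapAt_eq_transition_mul e e' hx (localFrame e' x)
  have h2 : e'.linearMapAt ℂ x (localFrame e' x) = 1 := by
    have h3 := e'.linearMapAt_symmₗ (R := ℂ) hx' 1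
    rwa [e'.symmₗ_apply hx'] at h3
  rw [h2, h0, zero_mul] at h1
  exact one_ne_zero h1

theorem continuousAt_transition (e e' : Trivialization ℂ (π ℂ L)) [MemTrivializationAtlas e]
    [MemTrivializationAtlas e'] {x : X} (hx : x ∈ e.baseSet) (hx' : x ∈ e'.baseSet) :
    ContinuousAt (transition e e') x := by
  have h := continuousOn_coordChange ℂ e e'
  have hU : e.baseSet ∩ e'.baseSet ∈ 𝓝 x := (e.open_baseSet.inter e'.open_baseSet).mem_nhds ⟨hx, hx'⟩
  have h2 : ContinuousAt (fun b => (e.coordChangeL ℂ e' b : ℂ →L[ℂ] ℂ) 1) x :=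
    (h.continuousAt hU).clm_apply continuousAt_const
  refine h2.congr ?_
  filter_upwards [hU] with y hy
  simp [transition, localFrame, Trivialization.coordChangeL_apply, hy, hy.2,
    Trivialization.linearMapAt_apply]

/-! ### Singular metrics -/

variable (L) in
/-- A singular metric `ψ` on `L`, given through its weights: `e^{-ψ_f} = |f|²` for the local frames
`f` of `L`, where `ψ_f` takes values in `[-∞, ∞]`. The weights of two frames `f = g f'` are related
by `|f|² = |g|² |f'|²`, that is by `ψ_{f'} = ψ_f + log |g|²`. -/
structure SingularMetric where
  /-- the weight `ψ_f : e.baseSet → [-∞, ∞]` in the frame `f` given by `e` -/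
  weight : ∀ (e : Trivialization ℂ (π ℂ L)) [MemTrivializationAtlas e], X → EReal
  weight_transition : ∀ (e e' : Trivialization ℂ (π ℂ L)) [MemTrivializationAtlas e]
    [MemTrivializationAtlas e'], ∀ x ∈ e.baseSet ∩ e'.baseSet,
      weight e' x = weight e x + ((Real.log (‖transition e e' x‖ ^ 2) : ℝ) : EReal)

theorem limsup_add_tendsto_real {α : Type*} {f : Filter α} [f.NeBot] (u : α → EReal) {c : α → ℝ}
    {c₀ : ℝ} (hc : Tendsto c f (𝓝 c₀)) :
    limsup (fun a => u a + (c a : EReal)) f = limsup u f + (c₀ : EReal) := by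
  have key : ∀ (w : α → EReal) {d : α → ℝ} {d₀ : ℝ}, Tendsto d f (𝓝 d₀) →
      limsup (fun a => w a + (d a : EReal)) f ≤ limsup w f + (d₀ : EReal) := by
    intro w d d₀ hd
    have hd' : limsup (fun a => (d a : EReal)) f = (d₀ : EReal) :=
      ((continuous_coe_real_ereal.tendsto d₀).comp hd).limsup_eq
    have h := EReal.limsup_add_le (f := f) (u := w) (v := fun a => (d a : EReal))
      (Or.inr (by rw [hd']; exact EReal.coe_ne_top _)) (Or.inr (by rw [hd']; exact EReal.coe_ne_bot _))
    rw [hd'] at h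
    exact h
  refine le_antisymm (key u hc) ?_
  have h := key (fun a => u a + (c a : EReal)) hc.neg
  have h2 : (fun a => (u a + (c a : EReal)) + ((-c a : ℝ) : EReal)) = u := by
    funext a
    rw [EReal.coe_neg, ← sub_eq_add_neg, EReal.add_sub_cancel_right]
  rw [h2, EReal.coe_neg, ← sub_eq_add_neg] at h
  calc limsup u f + (c₀ : EReal)
      ≤ (limsup (fun a => u a + (c a : EReal)) f - c₀) + c₀ := by gcongr
    _ = _ := EReal.sub_add_cancel

namespace SingularMetric

/-- The metric `ψ ≡ -∞`. -/
def bot : SingularMetric L where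
  weight _ _ _ := ⊥
  weight_transition := by intros; simp

/-- The metric `(1/k) log (∑ |sᵢ|²)` on `L` for sections `sᵢ` of `kL`: in a local frame `f` of `L`,
with `sᵢ = hᵢ f^{⊗k}`, its weight is `(1/k) log (∑ |hᵢ|²)`, with `log 0 = -∞`. -/
def ofSections (k : ℕ+) {m : ℕ} (s : Fin m → PowSection L k) : SingularMetric L where
  weight e _ x :=
    ((1 / (k : ℝ) : ℝ) : EReal) * ENNReal.log (ENNReal.ofReal (∑ i, ‖powCoord e k x (s i x)‖ ^ 2))
  weight_transition := by
    intro e e' _ _ x hx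
    have hg := transition_ne_zero e e' hx.1 hx.2
    have hg0 : 0 < ‖transition e e' x‖ := norm_pos_iff.mpr hg
    have hk : (0 : ℝ) < k := by exact_mod_cast k.pos
    have hsum : ∑ i, ‖powCoord e' k x (s i x)‖ ^ 2 =
        (‖transition e e' x‖ ^ 2) ^ (k : ℕ) * ∑ i, ‖powCoord e k x (s i x)‖ ^ 2 := by
      rw [Finset.mul_sum]
      refine Finset.sum_congr rfl fun i _ => ?_
      rw [powCoord_eq_transition_mul e e' k hx.1, norm_mul, norm_pow, mul_pow, ← pow_mul, ← pow_mul,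
        mul_comm (k : ℕ) 2]
    have hlog : ENNReal.log (ENNReal.ofReal ((‖transition e e' x‖ ^ 2) ^ (k : ℕ))) =
        (((k : ℝ) * Real.log (‖transition e e' x‖ ^ 2) : ℝ) : EReal) := by
      rw [ENNReal.log_ofReal_of_pos (by positivity), Real.log_pow]
    rw [hsum, ENNReal.ofReal_mul (by positivity), ENNReal.log_mul_add, hlog,
      EReal.left_distrib_of_nonneg_of_ne_top (by exact_mod_cast (by positivity))
        (EReal.coe_ne_top _), ← EReal.coe_mul, add_comm]
    congr 2
    field_simp

/-- The pointwise upper limit `limsup_{k → ∞} ψ_k` of a sequence of metrics. -/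
def limsup (ψ : ℕ+ → SingularMetric L) : SingularMetric L where
  weight e _ x := Filter.limsup (fun k => (ψ k).weight e x) atTop
  weight_transition := by
    intro e e' _ _ x hx
    rw [← limsup_add_tendsto_real _ tendsto_const_nhds]
    congr 1
    funext k
    exact (ψ k).weight_transition e e' x hx

/-- The upper semicontinuous regularization `ψ^*`: its weights are the upper semicontinuous
regularizations `ψ_f^*(x) = limsup_{y → x} ψ_f(y)` of the weights of `ψ`. -/
def uscReg (ψ : SingularMetric L) : SingularMetric L where
  weight e _ x := Filter.limsup (fun y => ψ.weight e y) (𝓝 x)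
  weight_transition := by
    intro e e' _ _ x hx
    have hc : Tendsto (fun y => Real.log (‖transition e e' y‖ ^ 2)) (𝓝 x)
        (𝓝 (Real.log (‖transition e e' x‖ ^ 2))) := by
      have h1 : ContinuousAt (transition e e') x := continuousAt_transition e e' hx.1 hx.2
      refine (h1.norm.pow 2).log ?_
      exact pow_ne_zero 2 (norm_ne_zero_iff.mpr (transition_ne_zero e e' hx.1 hx.2))
    rw [← limsup_add_tendsto_real _ hc]
    refine Filter.limsup_congr ?_
    filter_upwards [(e.open_baseSet.inter e'.open_baseSet).mem_nhds hx] with y hy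
    exact ψ.weight_transition e e' y hy

/-- `ψ` is more singular than `φ`: there is a constant `C` with `ψ ≤ φ + C`. -/
def MoreSingular (ψ φ : SingularMetric L) : Prop :=
  ∃ C : ℝ, ∀ (e : Trivialization ℂ (π ℂ L)) [MemTrivializationAtlas e], ∀ x ∈ e.baseSet,
    ψ.weight e x ≤ φ.weight e x + (C : EReal)

/-- The equivalence `ψ ∼ φ`; its classes are the singularity types. -/
def Equivalent (ψ φ : SingularMetric L) : Prop :=
  MoreSingular ψ φ ∧ MoreSingular φ ψ

end SingularMetric

/-! ### Hermitian metrics -/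

variable (L) in
/-- A hermitian metric on the line bundle `L`: a scalar product on each fibre. As the fibres are
complex lines, it is recorded by its squared norm `v ↦ |v|²`. -/
structure HermitianMetric where
  normSq : ∀ x, L x → ℝ
  normSq_smul : ∀ x (c : ℂ) (v : L x), normSq x (c • v) = ‖c‖ ^ 2 * normSq x v
  normSq_pos : ∀ x (v : L x), v ≠ 0 → 0 < normSq x v

namespace HermitianMetric

/-- The weight `φ_f` of the hermitian metric in the frame `f` given by `e`: `|f|² = e^{-φ_f}`. -/
def weight (φ : HermitianMetric L) (e : Trivialization ℂ (π ℂ L)) (x : X) : ℝ :=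
  -Real.log (φ.normSq x (localFrame e x))

/-- The hermitian product `s(x) \overline{t(x)} e^{-kφ(x)}` of two sections of `kL`, computed in a
frame of `L` around `x`. -/
def pairing (φ : HermitianMetric L) (k : ℕ) (s t : PowSection L k) (x : X) : ℂ :=
  powCoord (trivializationAt ℂ L x) k x (s x) *
    (starRingEnd ℂ) (powCoord (trivializationAt ℂ L x) k x (t x)) *
    (Real.exp (-(k * φ.weight (trivializationAt ℂ L x) x)) : ℝ)

variable [MeasurableSpace X]

/-- The scalar product `(s, t)_{kφ} = ∫_X s \overline{t} e^{-kφ} dV` on the sections of `kL`. -/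
def l2Inner (φ : HermitianMetric L) (dV : Measure X) (k : ℕ) (s t : PowSection L k) : ℂ :=
  ∫ x, φ.pairing k s t x ∂dV

/-- `s₁, …, sₘ` is an orthonormal basis of the subspace `W` for `(·,·)_{kφ}`. -/
def IsOrthonormalBasis (φ : HermitianMetric L) (dV : Measure X) (k : ℕ)
    (W : Submodule ℂ (PowSection L k)) {m : ℕ} (s : Fin m → PowSection L k) : Prop :=
  (∀ i j, φ.l2Inner dV k (s i) (s j) = if i = j then 1 else 0) ∧
    Submodule.span ℂ (Set.range s) = W

open Classical in
/-- The metric `(1/k) log (∑ |sᵢ|²)` for an orthonormal basis `sᵢ` of `W`; it does not depend on the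
choice of the basis. (On a compact complex manifold, a space `W` of holomorphic sections is finite
dimensional, so that such a basis exists; the value `-∞` in the other case is never used.) -/
def bergman (φ : HermitianMetric L) (dV : Measure X) (k : ℕ+)
    (W : Submodule ℂ (PowSection L k)) : SingularMetric L :=
  if h : ∃ (m : ℕ) (s : Fin m → PowSection L k), φ.IsOrthonormalBasis dV k W s then
    SingularMetric.ofSections k h.choose_spec.choose
  else SingularMetric.bot

end HermitianMetric

/-! ### Holomorphic objects -/

variable (n : ℕ) [ChartedSpace (Cn n) X]

variable (L) in
/-- `H⁰(X, kL)`, the holomorphic sections of `kL`: in the local holomorphic frames `f^{⊗k}` their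
coordinates are holomorphic functions. -/
def holoSections (k : ℕ) : Submodule ℂ (PowSection L k) where
  carrier := {s | ∀ (e : Trivialization ℂ (π ℂ L)) [MemTrivializationAtlas e],
    MDifferentiableOn 𝓘(ℂ, Cn n) 𝓘(ℂ, ℂ) (fun x => powCoord e k x (s x)) e.baseSet}
  add_mem' := by
    intro s t hs ht e _
    simp only [Pi.add_apply, map_add]
    exact (hs e).add (ht e)
  zero_mem' := by
    intro e _
    simp only [Pi.zero_apply, map_zero]
    exact mdifferentiableOn_const
  smul_mem' := by
    intro c s hs e _
    simp only [Pi.smul_apply, map_smul]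
    exact (hs e).const_smul c

/-- The Levi form `∑ ∂²u/∂zᵢ∂z̄ⱼ vᵢ v̄ⱼ` of a function `u` on `ℂⁿ`, which is
`(D²u(v, v) + D²u(iv, iv)) / 4`. -/
def leviForm {n : ℕ} (u : Cn n → ℝ) (z v : Cn n) : ℝ :=
  (fderiv ℝ (fderiv ℝ u) z v v + fderiv ℝ (fderiv ℝ u) z (Complex.I • v) (Complex.I • v)) / 4

namespace HermitianMetric

/-- The metric is smooth: its weights in the local holomorphic frames are `C^∞` functions. -/
def IsSmooth (φ : HermitianMetric L) : Prop :=
  ∀ (e : Trivialization ℂ (π ℂ L)) [MemTrivializationAtlas e],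
    ContMDiffOn 𝓘(ℝ, Cn n) 𝓘(ℝ, ℝ) ∞ (φ.weight e) e.baseSet

/-- The curvature `dd^c φ = (i/π) ∂∂̄ φ` of the (smooth) metric is a strictly positive `(1,1)`-form:
the weights are strictly plurisubharmonic in the holomorphic charts. -/
def IsStrictlyPositive (φ : HermitianMetric L) : Prop :=
  ∀ (e : Trivialization ℂ (π ℂ L)) [MemTrivializationAtlas e], ∀ c ∈ atlas (Cn n) X,
    ∀ x ∈ c.source ∩ e.baseSet, ∀ v : Cn n, v ≠ 0 →
      0 < leviForm (fun z => φ.weight e (c.symm z)) (c x) v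

end HermitianMetric

variable (L) in
/-- `𝓗(L)`, the smooth strictly positive hermitian metrics on `L`. -/
def positiveMetrics : Set (HermitianMetric L) :=
  {φ | φ.IsSmooth n ∧ φ.IsStrictlyPositive n}

/-- `dV` is (the measure of) a smooth volume form on `X`: in every chart it is a smooth positive
density times Lebesgue measure. -/
def IsSmoothVolume [MeasurableSpace X] (dV : Measure X) : Prop :=
  ∀ c ∈ atlas (Cn n) X, ∃ ρ : Cn n → ℝ, ContDiffOn ℝ ∞ ρ c.target ∧ (∀ z ∈ c.target, 0 < ρ z) ∧
    (dV.restrict c.source).map c =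
      (volume.restrict c.target).withDensity fun z => ENNReal.ofReal (ρ z)

/-! ### Filtrations of the section ring -/

variable (L) in
/-- A filtration of the section ring `R(L) = ⊕ₖ H⁰(kL)`: for every `k`, a family
`space t k = 𝓕_t H⁰(kL)` of subspaces, decreasing and left-continuous in `t ∈ ℝ`. -/
structure SectionFiltration where
  space : ℝ → ∀ k : ℕ, Submodule ℂ (PowSection L k)
  space_le : ∀ t k, space t k ≤ holoSections L n k
  antitone : ∀ k, Antitone fun t => space t k
  left_continuous : ∀ t k, ⨅ s ∈ Set.Iio t, space s k = space t k

namespace SectionFiltration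

variable {n}

/-- `(𝓕_t H⁰(kL)) (𝓕_s H⁰(mL)) ⊆ 𝓕_{t+s} H⁰((k+m)L)`. -/
def IsMultiplicative (F : SectionFiltration L n) : Prop :=
  ∀ (t s : ℝ) (k m : ℕ), ∀ a ∈ F.space t k, ∀ b ∈ F.space s m, a.mul b ∈ F.space (t + s) (k + m)

/-- `𝓕_{-kC} H⁰(kL) = H⁰(kL)` and `𝓕_{kC} H⁰(kL) = 0` for all `k ≥ 1`, for some constant `C`. -/
def IsBounded (F : SectionFiltration L n) : Prop :=
  ∃ C : ℝ, ∀ k : ℕ, 1 ≤ k →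
    F.space (-(k * C)) k = holoSections L n k ∧ F.space (k * C) k = ⊥

end SectionFiltration

variable {n} [MeasurableSpace X]

/-- The metric `φ_{k,λ} = (1/k) log (∑ |s_{i,λ}|²)`, where `s_{i,λ}` is an orthonormal basis of
`𝓕_{kλ} H⁰(kL)` for `(·,·)_{kφ}`. -/
def HermitianMetric.filtrationBergman (φ : HermitianMetric L) (dV : Measure X)
    (F : SectionFiltration L n) (lam : ℝ) (k : ℕ+) : SingularMetric L :=
  φ.bergman dV k (F.space ((k : ℝ) * lam) k)

/-- The metric `φ_λ^𝓕 = (limsup_{k → ∞} φ_{k,λ})^*`. -/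
def HermitianMetric.filtrationMetric (φ : HermitianMetric L) (dV : Measure X)
    (F : SectionFiltration L n) (lam : ℝ) : SingularMetric L :=
  (SingularMetric.limsup (φ.filtrationBergman dV F lam)).uscReg

end LineBundles

end

/-! The difference of two smooth metrics on `L` is a global continuous function, so by compactness
`φ ≤ ψ + C` for some constant `C` (`IsSmooth.exists_weight_le`). Hence `e^{-kψ} ≤ e^{kC} e^{-kφ}`,
and the `L²` products on any space `W` of holomorphic sections of `kL` satisfy `‖u‖²_{kψ} ≤ e^{kC}
‖u‖²_{kφ}`.

For an orthonormal basis `sᵢ` of `W`, the sum `∑ |sᵢ(x)|²` is the squared dual norm of evaluation at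
`x`. Dual norms reverse inequalities, so the Bergman kernel of `φ` is at most `e^{kC}` times that of
`ψ` (`sum_norm_sq_le_of_form_le`). Under `(1/k) log` the factor becomes `C`, independent of `k` and
of `W`, so the bound survives the upper limit and the regularization. Exchanging `φ` and `ψ` gives
the equivalence.

Since `bergman` is `-∞` when no orthonormal basis exists, it also has to be shown that such a basis
exists for `φ` exactly when it does for `ψ` (`IsOrthonormalBasis.exists_of_weight_le`). -/

/-! ### Linear algebra: orthonormal bases and dual norms -/

section ScalarProducts

variable {V : Type*} [AddCommGroup V] [Module ℂ V]

/-- A positive definite hermitian form on a finite dimensional complex vector space has an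
orthonormal basis. -/
theorem exists_orthonormal_spanning [FiniteDimensional ℂ V] (B : V →ₗ[ℂ] V →ₗ⋆[ℂ] ℂ)
    (conj_symm : ∀ u v, (starRingEnd ℂ) (B u v) = B v u)
    (pos : ∀ u, u ≠ 0 → 0 < (B u u).re) :
    ∃ (m : ℕ) (s : Fin m → V), (∀ i j, B (s i) (s j) = if i = j then 1 else 0) ∧
      Submodule.span ℂ (Set.range s) = ⊤ := by
  let core : InnerProductSpace.Core ℂ V :=
    -- The arguments are swapped because `inner` is conjugate-linear in its first variable, while
    -- `B` is so in its second.
    { inner := fun u v => B v u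
      conj_inner_symm := fun u v => conj_symm u v
      re_inner_nonneg := fun u => by
        rcases eq_or_ne u 0 with rfl | hu
        · simp
        · exact (pos u hu).le
      add_left := fun u v w => by simp
      smul_left := fun u v c => by simp
      definite := fun u hu => by
        by_contra h
        have := pos u h
        rw [hu] at this
        simp at this }
  let _ : NormedAddCommGroup V := core.toNormedAddCommGroup
  let _ : InnerProductSpace ℂ V := InnerProductSpace.ofCore core.toCore
  have b := stdOrthonormalBasis ℂ V
  refine ⟨_, b, fun i j => ?_, by simpa using b.toBasis.span_eq⟩
  have h : B (b i) (b j) = if j = i then (1 : ℂ) else 0 :=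
    orthonormal_iff_ite.mp b.orthonormal j i
  rw [h]
  simp only [eq_comm]

/-- The square norm of a vector in terms of its coordinates in an orthonormal family. -/
theorem form_sum_smul_self {m : ℕ} (B : V →ₗ[ℂ] V →ₗ⋆[ℂ] ℂ) {s : Fin m → V}
    (hs : ∀ i j, B (s i) (s j) = if i = j then 1 else 0) (c : Fin m → ℂ) :
    (B (∑ i, c i • s i) (∑ i, c i • s i)).re = ∑ i, ‖c i‖ ^ 2 := by
  have h : B (∑ i, c i • s i) (∑ i, c i • s i) = ((∑ i, ‖c i‖ ^ 2 : ℝ) : ℂ) := by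
    simp [hs, Complex.conj_mul']
  rw [h, Complex.ofReal_re]

/-- If `B' ≤ A B` for two scalar products on the same space, then the square norms of a linear form
with respect to `B` and `B'`, computed in orthonormal bases, satisfy the inequality with the roles
of `B` and `B'` exchanged. -/
theorem sum_norm_sq_le_of_form_le {m m' : ℕ} (B B' : V →ₗ[ℂ] V →ₗ⋆[ℂ] ℂ) {s : Fin m → V}
    {t : Fin m' → V} (hs : ∀ i j, B (s i) (s j) = if i = j then 1 else 0)
    (ht : ∀ i j, B' (t i) (t j) = if i = j then 1 else 0)
    (hspan : Submodule.span ℂ (Set.range t) = ⊤) {A : ℝ} (hA : 0 ≤ A)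
    (hBB' : ∀ u, (B' u u).re ≤ A * (B u u).re) (l : V →ₗ[ℂ] ℂ) :
    ∑ i, ‖l (s i)‖ ^ 2 ≤ A * ∑ i, ‖l (t i)‖ ^ 2 := by
  set S := ∑ i, ‖l (s i)‖ ^ 2 with hS
  set T := ∑ i, ‖l (t i)‖ ^ 2 with hT
  have hS0 : 0 ≤ S := Finset.sum_nonneg fun i _ => by positivity
  have hT0 : 0 ≤ T := Finset.sum_nonneg fun i _ => by positivity
  -- The Riesz vector of `l`: `l v = B v u` on the span of `s`, so `l u = B u u = S`.
  set u := ∑ i, (starRingEnd ℂ) (l (s i)) • s i with hu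
  have hBu : (B u u).re = S := by
    rw [hu, form_sum_smul_self B hs]
    simp [hS]
  have hlu : l u = (S : ℂ) := by
    simp only [hu, hS, map_sum, map_smul, smul_eq_mul, Complex.ofReal_sum, Complex.ofReal_pow]
    exact Finset.sum_congr rfl fun i _ => Complex.conj_mul' _
  obtain ⟨c, hc⟩ := (Submodule.mem_span_range_iff_exists_fun ℂ).mp
    (hspan.symm ▸ Submodule.mem_top : u ∈ Submodule.span ℂ (Set.range t))
  have hB'u : (B' u u).re = ∑ i, ‖c i‖ ^ 2 := by rw [← hc, form_sum_smul_self B' ht]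
  -- Cauchy–Schwarz for `l u` in the basis `t`; with `B' u u ≤ A S` it gives `S² ≤ A S T`, and one
  -- factor `S` cancels unless `S = 0`.
  have hcs : S ^ 2 ≤ (∑ i, ‖c i‖ ^ 2) * T := by
    have h1 : S ≤ ∑ i, ‖c i‖ * ‖l (t i)‖ := by
      calc S = ‖l u‖ := by rw [hlu, Complex.norm_real, Real.norm_of_nonneg hS0]
        _ = ‖∑ i, c i * l (t i)‖ := by rw [← hc]; simp
        _ ≤ ∑ i, ‖c i * l (t i)‖ := norm_sum_le _ _
        _ = _ := by simp
    exact (pow_le_pow_left₀ hS0 h1 2).trans (Finset.sum_mul_sq_le_sq_mul_sq _ _ _)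
  have h2 := hBB' u
  rw [hBu, hB'u] at h2
  rcases hS0.eq_or_lt with h0 | h0
  · rw [← h0]
    positivity
  · refine le_of_mul_le_mul_right ?_ h0
    calc S * S = S ^ 2 := (sq S).symm
      _ ≤ A * S * T := hcs.trans (mul_le_mul_of_nonneg_right h2 hT0)
      _ = A * T * S := by ring

end ScalarProducts

/-! ### Change of frame -/

section LineBundles

variable {X : Type*} [TopologicalSpace X]
  {L : X → Type*} [∀ x, AddCommGroup (L x)] [∀ x, Module ℂ (L x)] [∀ x, TopologicalSpace (L x)]
  [TopologicalSpace (TotalSpace ℂ L)] [FiberBundle ℂ L] [VectorBundle ℂ ℂ L]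

theorem localFrame_eq_transition_smul (e e' : Trivialization ℂ (π ℂ L))
    [MemTrivializationAtlas e] [MemTrivializationAtlas e'] {x : X} (hx' : x ∈ e'.baseSet) :
    localFrame e x = transition e e' x • localFrame e' x := by
  have h1 : e'.symmₗ ℂ x (e'.linearMapAt ℂ x (localFrame e x)) = localFrame e x :=
    e'.symmₗ_linearMapAt hx' _
  have h2 : e'.symmₗ ℂ x (transition e e' x • (1 : ℂ)) =
      transition e e' x • e'.symmₗ ℂ x 1 := map_smul _ _ _
  rw [smul_eq_mul, mul_one, e'.symmₗ_apply hx' 1] at h2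
  exact h1.symm.trans h2

theorem localFrame_ne_zero (e : Trivialization ℂ (π ℂ L)) [MemTrivializationAtlas e] {x : X}
    (hx : x ∈ e.baseSet) : localFrame e x ≠ 0 := by
  intro h
  have h1 := e.linearMapAt_symmₗ (R := ℂ) hx 1
  rw [e.symmₗ_apply hx] at h1
  change e.linearMapAt ℂ x (localFrame e x) = 1 at h1
  rw [h, map_zero] at h1
  exact zero_ne_one h1

/-! ### Stability of bounds between singular metrics -/

namespace SingularMetric

/-- `(1/k) log` turns the factor `e^{kC}` into the summand `C`, also where the sums vanish, since
`EReal` arithmetic allows `log 0 = ⊥`. -/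
theorem ofSections_weight_le {k : ℕ+} {m m' : ℕ} {s : Fin m → PowSection L k}
    {t : Fin m' → PowSection L k} {C : ℝ} (e : Trivialization ℂ (π ℂ L))
    [MemTrivializationAtlas e] {x : X}
    (h : ∑ i, ‖powCoord e k x (s i x)‖ ^ 2 ≤
      Real.exp (k * C) * ∑ i, ‖powCoord e k x (t i x)‖ ^ 2) :
    (ofSections k s).weight e x ≤ (ofSections k t).weight e x + (C : EReal) := by
  have hk : (0 : ℝ) < k := by exact_mod_cast k.pos
  have hk' : (0 : EReal) ≤ ((1 / (k : ℝ) : ℝ) : EReal) := by exact_mod_cast (by positivity)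
  change ((1 / (k : ℝ) : ℝ) : EReal) * _ ≤ ((1 / (k : ℝ) : ℝ) : EReal) * _ + _
  refine (mul_le_mul_of_nonneg_left
    (ENNReal.log_monotone (ENNReal.ofReal_le_ofReal h)) hk').trans_eq ?_
  rw [ENNReal.ofReal_mul (Real.exp_pos _).le, ENNReal.log_mul_add,
    ENNReal.log_ofReal_of_pos (Real.exp_pos _), Real.log_exp,
    EReal.left_distrib_of_nonneg_of_ne_top hk' (EReal.coe_ne_top _), ← EReal.coe_mul, add_comm]
  congr 2
  field_simp

theorem limsup_weight_le {u v : ℕ+ → SingularMetric L} {C : ℝ} (e : Trivialization ℂ (π ℂ L))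
    [MemTrivializationAtlas e] {x : X}
    (h : ∀ k, (u k).weight e x ≤ (v k).weight e x + (C : EReal)) :
    (limsup u).weight e x ≤ (limsup v).weight e x + (C : EReal) := by
  change Filter.limsup _ _ ≤ Filter.limsup _ _ + _
  rw [← limsup_add_tendsto_real _ tendsto_const_nhds]
  exact Filter.limsup_le_limsup (Eventually.of_forall h)

/-- The regularization at `x` depends only on values near `x`, and the bound holds on the open set
`e.baseSet`. -/
theorem MoreSingular.uscReg {u v : SingularMetric L} (h : u.MoreSingular v) :
    u.uscReg.MoreSingular v.uscReg := by
  obtain ⟨C, hC⟩ := h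
  refine ⟨C, fun e _ x hx => ?_⟩
  change Filter.limsup _ _ ≤ Filter.limsup _ _ + _
  rw [← limsup_add_tendsto_real _ tendsto_const_nhds]
  refine Filter.limsup_le_limsup ?_
  filter_upwards [e.open_baseSet.mem_nhds hx] with y hy
  exact hC e y hy

end SingularMetric

/-! ### Pointwise hermitian products -/

namespace HermitianMetric

theorem weight_eq_add_transition (φ : HermitianMetric L) (e e' : Trivialization ℂ (π ℂ L))
    [MemTrivializationAtlas e] [MemTrivializationAtlas e'] {x : X} (hx : x ∈ e.baseSet)
    (hx' : x ∈ e'.baseSet) :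
    φ.weight e' x = φ.weight e x + Real.log (‖transition e e' x‖ ^ 2) := by
  have hg : ‖transition e e' x‖ ^ 2 ≠ 0 :=
    pow_ne_zero 2 (norm_ne_zero_iff.mpr (transition_ne_zero e e' hx hx'))
  rw [weight, weight, localFrame_eq_transition_smul e e' hx', φ.normSq_smul,
    Real.log_mul hg (φ.normSq_pos x _ (localFrame_ne_zero e' hx')).ne']
  ring

/-- `pairing` uses a frame that varies with `x`; its independence of the frame gives an expression
in one fixed frame, from which continuity can be read off. -/
theorem pairing_eq (φ : HermitianMetric L) (k : ℕ) (s t : PowSection L k)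
    (e : Trivialization ℂ (π ℂ L)) [MemTrivializationAtlas e] {x : X} (hx : x ∈ e.baseSet) :
    φ.pairing k s t x = powCoord e k x (s x) * (starRingEnd ℂ) (powCoord e k x (t x)) *
      (Real.exp (-(k * φ.weight e x)) : ℝ) := by
  have hx' := mem_baseSet_trivializationAt ℂ L x
  set e' := trivializationAt ℂ L x
  set g := transition e e' x with hg
  have hg0 : g ≠ 0 := transition_ne_zero e e' hx hx'
  have hexp : Real.exp (-(k * φ.weight e' x)) =
      ((‖g‖ ^ 2) ^ k)⁻¹ * Real.exp (-(k * φ.weight e x)) := by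
    rw [φ.weight_eq_add_transition e e' hx hx', mul_add, neg_add, Real.exp_add, mul_comm]
    congr 1
    rw [Real.exp_neg, ← Real.log_pow, Real.exp_log (by positivity)]
  have hgg : g ^ k * (starRingEnd ℂ) (g ^ k) = (((‖g‖ ^ 2) ^ k : ℝ) : ℂ) := by
    rw [Complex.mul_conj', norm_pow]
    push_cast
    ring
  change powCoord e' k x (s x) * (starRingEnd ℂ) (powCoord e' k x (t x)) *
    (Real.exp (-(k * φ.weight e' x)) : ℝ) = _
  rw [powCoord_eq_transition_mul e e' k hx, powCoord_eq_transition_mul e e' k hx,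
    ← hg, hexp, map_mul]
  have hne : (((‖g‖ ^ 2) ^ k : ℝ) : ℂ) ≠ 0 := by exact_mod_cast (by positivity)
  rw [Complex.ofReal_mul, Complex.ofReal_inv]
  -- The factor `|g|^{2k}` from the two coordinates cancels its inverse from the weight.
  linear_combination powCoord e k x (s x) * (starRingEnd ℂ) (powCoord e k x (t x)) *
    (Real.exp (-(k * φ.weight e x)) : ℝ) *
      ((((‖g‖ ^ 2) ^ k : ℝ) : ℂ)⁻¹ * hgg + mul_inv_cancel₀ hne)

theorem pairing_add_left (φ : HermitianMetric L) (k : ℕ) (s s' t : PowSection L k) :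
    φ.pairing k (s + s') t = φ.pairing k s t + φ.pairing k s' t := by
  funext x
  simp only [pairing, Pi.add_apply, map_add]
  ring

theorem pairing_smul_left (φ : HermitianMetric L) (k : ℕ) (c : ℂ) (s t : PowSection L k) :
    φ.pairing k (c • s) t = fun x => c * φ.pairing k s t x := by
  funext x
  simp only [pairing, Pi.smul_apply, map_smul, smul_eq_mul]
  ring

theorem conj_pairing (φ : HermitianMetric L) (k : ℕ) (s t : PowSection L k) (x : X) :
    (starRingEnd ℂ) (φ.pairing k s t x) = φ.pairing k t s x := by
  simp only [pairing, map_mul, Complex.conj_conj, Complex.conj_ofReal]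
  ring

theorem re_pairing_self (φ : HermitianMetric L) (k : ℕ) (s : PowSection L k) (x : X) :
    (φ.pairing k s s x).re = ‖powCoord (trivializationAt ℂ L x) k x (s x)‖ ^ 2 *
      Real.exp (-(k * φ.weight (trivializationAt ℂ L x) x)) := by
  rw [pairing, Complex.mul_conj', ← Complex.ofReal_pow, ← Complex.ofReal_mul, Complex.ofReal_re]

theorem re_pairing_self_le {φ ψ : HermitianMetric L} {C : ℝ}
    (h : ∀ x, φ.weight (trivializationAt ℂ L x) x ≤ ψ.weight (trivializationAt ℂ L x) x + C)
    (k : ℕ) (s : PowSection L k) (x : X) :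
    (ψ.pairing k s s x).re ≤ Real.exp (k * C) * (φ.pairing k s s x).re := by
  rw [re_pairing_self, re_pairing_self, mul_left_comm, ← Real.exp_add]
  gcongr
  nlinarith [mul_le_mul_of_nonneg_left (h x) (Nat.cast_nonneg (α := ℝ) k)]

/-! ### The `L²` product -/

section L2

variable [MeasurableSpace X] (dV : Measure X)

theorem l2Inner_smul_left (φ : HermitianMetric L) {k : ℕ} (c : ℂ) (s t : PowSection L k) :
    φ.l2Inner dV k (c • s) t = c * φ.l2Inner dV k s t := by
  rw [l2Inner, pairing_smul_left]
  exact integral_const_mul _ _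

theorem conj_l2Inner (φ : HermitianMetric L) {k : ℕ} (s t : PowSection L k) :
    (starRingEnd ℂ) (φ.l2Inner dV k s t) = φ.l2Inner dV k t s := by
  rw [l2Inner, ← integral_conj]
  exact integral_congr_ae (Eventually.of_forall fun x => φ.conj_pairing k s t x)

/-- Integration of `re_pairing_self_le`; integrability excludes the default value `0` of the Bochner
integral. -/
theorem re_l2Inner_self_le {φ ψ : HermitianMetric L} {C : ℝ}
    (h : ∀ x, φ.weight (trivializationAt ℂ L x) x ≤ ψ.weight (trivializationAt ℂ L x) x + C)
    {k : ℕ} {s : PowSection L k} (hφ : Integrable (φ.pairing k s s) dV)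
    (hψ : Integrable (ψ.pairing k s s) dV) :
    (ψ.l2Inner dV k s s).re ≤ Real.exp (k * C) * (φ.l2Inner dV k s s).re := by
  have h1 : ∀ {χ : HermitianMetric L}, Integrable (χ.pairing k s s) dV →
      (χ.l2Inner dV k s s).re = ∫ x, (χ.pairing k s s x).re ∂dV := fun hχ => (integral_re hχ).symm
  rw [h1 hφ, h1 hψ, ← integral_const_mul]
  exact integral_mono hψ.re (hφ.re.const_mul _) fun x => re_pairing_self_le h k s x

end L2

/-! ### Smooth metrics: bounded difference and continuous pairings -/

section Smooth

variable {n : ℕ} [ChartedSpace (Cn n) X]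

theorem IsSmooth.exists_weight_le [CompactSpace X] {φ ψ : HermitianMetric L} (hφ : φ.IsSmooth n)
    (hψ : ψ.IsSmooth n) :
    ∃ C : ℝ, ∀ x, φ.weight (trivializationAt ℂ L x) x ≤
      ψ.weight (trivializationAt ℂ L x) x + C := by
  -- The frame jumps with `x`, but both weights change by the same `log |g|²`, so near `x₀` the
  -- difference can be computed in the frame at `x₀`.
  have hcont : Continuous fun x =>
      φ.weight (trivializationAt ℂ L x) x - ψ.weight (trivializationAt ℂ L x) x := by
    refine continuous_iff_continuousAt.mpr fun x₀ => ?_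
    set e := trivializationAt ℂ L x₀
    have hU := e.open_baseSet.mem_nhds (mem_baseSet_trivializationAt ℂ L x₀)
    refine (((hφ e).continuousOn.continuousAt hU).sub
      ((hψ e).continuousOn.continuousAt hU)).congr ?_
    filter_upwards [hU] with x hx
    have hx' := mem_baseSet_trivializationAt ℂ L x
    rw [Pi.sub_apply, φ.weight_eq_add_transition e _ hx hx', ψ.weight_eq_add_transition e _ hx hx',
      add_sub_add_right_eq_sub]
  obtain ⟨C, hC⟩ := (isCompact_range hcont).bddAbove
  exact ⟨C, fun x => sub_le_iff_le_add'.mp (hC ⟨x, rfl⟩)⟩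

theorem IsSmooth.continuous_pairing {φ : HermitianMetric L} (hφ : φ.IsSmooth n) {k : ℕ}
    {s t : PowSection L k} (hs : s ∈ holoSections L n k) (ht : t ∈ holoSections L n k) :
    Continuous (φ.pairing k s t) := by
  refine continuous_iff_continuousAt.mpr fun x₀ => ?_
  set e := trivializationAt ℂ L x₀
  have hU := e.open_baseSet.mem_nhds (mem_baseSet_trivializationAt ℂ L x₀)
  have h1 := (hs e).continuousOn.continuousAt hU
  have h2 := (ht e).continuousOn.continuousAt hU
  have h3 := (hφ e).continuousOn.continuousAt hU
  refine ((h1.mul (Complex.continuous_conj.continuousAt.comp h2)).mul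
    (Complex.continuous_ofReal.continuousAt.comp
      (Real.continuous_exp.continuousAt.comp (h3.const_mul (k : ℝ)).neg))).congr ?_
  filter_upwards [hU] with x hx
  exact (φ.pairing_eq k s t e hx).symm

/-! ### Comparison of Bergman metrics -/

variable [CompactSpace X] [MeasurableSpace X] [BorelSpace X] (dV : Measure X) [IsFiniteMeasure dV]

theorem IsSmooth.integrable_pairing {φ : HermitianMetric L} (hφ : φ.IsSmooth n) {k : ℕ}
    {s t : PowSection L k} (hs : s ∈ holoSections L n k) (ht : t ∈ holoSections L n k) :
    Integrable (φ.pairing k s t) dV :=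
  (hφ.continuous_pairing hs ht).integrable_of_hasCompactSupport
    (HasCompactSupport.of_compactSpace _)

theorem IsSmooth.l2Inner_add_left {φ : HermitianMetric L} (hφ : φ.IsSmooth n) {k : ℕ}
    {s s' t : PowSection L k} (hs : s ∈ holoSections L n k) (hs' : s' ∈ holoSections L n k)
    (ht : t ∈ holoSections L n k) :
    φ.l2Inner dV k (s + s') t = φ.l2Inner dV k s t + φ.l2Inner dV k s' t := by
  rw [l2Inner, pairing_add_left]
  exact integral_add (hφ.integrable_pairing dV hs ht) (hφ.integrable_pairing dV hs' ht)

/-- The scalar product `(·,·)_{kφ}` on a space of holomorphic sections, as a sesquilinear form. -/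
noncomputable def IsSmooth.form {φ : HermitianMetric L} (hφ : φ.IsSmooth n) {k : ℕ}
    {W : Submodule ℂ (PowSection L k)} (hW : W ≤ holoSections L n k) : W →ₗ[ℂ] W →ₗ⋆[ℂ] ℂ :=
  LinearMap.mk₂'ₛₗ (RingHom.id ℂ) (starRingEnd ℂ) (fun s t => φ.l2Inner dV k s.1 t.1)
    (fun s s' t => hφ.l2Inner_add_left dV (hW s.2) (hW s'.2) (hW t.2))
    (fun c s t => φ.l2Inner_smul_left dV c s.1 t.1)
    (fun s t t' => by
      rw [← conj_l2Inner, Submodule.coe_add, hφ.l2Inner_add_left dV (hW t.2) (hW t'.2) (hW s.2),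
        map_add, conj_l2Inner, conj_l2Inner])
    (fun c s t => by
      rw [← conj_l2Inner, Submodule.coe_smul, l2Inner_smul_left, map_mul, conj_l2Inner, smul_eq_mul])

variable {k : ℕ} {W : Submodule ℂ (PowSection L k)}

/-- Regards the basis as vectors of `W` itself, where the linear algebra of sesquilinear forms
applies. -/
theorem IsOrthonormalBasis.exists_subtype {φ : HermitianMetric L} (hφ : φ.IsSmooth n)
    (hW : W ≤ holoSections L n k) {m : ℕ} {s : Fin m → PowSection L k}
    (hs : φ.IsOrthonormalBasis dV k W s) :
    ∃ s' : Fin m → W, (∀ i, (s' i : PowSection L k) = s i) ∧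
      (∀ i j, hφ.form dV hW (s' i) (s' j) = if i = j then 1 else 0) ∧
      Submodule.span ℂ (Set.range s') = ⊤ := by
  have hmem : ∀ i, s i ∈ W := fun i => hs.2 ▸ Submodule.subset_span ⟨i, rfl⟩
  refine ⟨fun i => ⟨s i, hmem i⟩, fun i => rfl, hs.1, ?_⟩
  refine Submodule.map_injective_of_injective W.injective_subtype ?_
  rw [Submodule.map_span, ← Set.range_comp, Submodule.map_subtype_top]
  exact hs.2

/-- The existence of an orthonormal basis of `W` does not depend on the smooth metric. -/
theorem IsOrthonormalBasis.exists_of_weight_le {φ ψ : HermitianMetric L} (hφ : φ.IsSmooth n)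
    (hψ : ψ.IsSmooth n) (hW : W ≤ holoSections L n k) {C : ℝ}
    (h : ∀ x, φ.weight (trivializationAt ℂ L x) x ≤ ψ.weight (trivializationAt ℂ L x) x + C)
    {m : ℕ} {t : Fin m → PowSection L k} (ht : ψ.IsOrthonormalBasis dV k W t) :
    ∃ (m' : ℕ) (s : Fin m' → PowSection L k), φ.IsOrthonormalBasis dV k W s := by
  obtain ⟨t', -, ht', hspan⟩ := ht.exists_subtype dV hψ hW
  have : FiniteDimensional ℂ W :=
    ⟨hspan ▸ Submodule.fg_span (Set.finite_range t')⟩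
  -- Definiteness is inherited from `ψ`: its form is `∑ |cᵢ|²` in the basis `t'` and is at most
  -- `e^{kC}` times that of `φ`.
  have hpos : ∀ u : W, u ≠ 0 → 0 < (hφ.form dV hW u u).re := by
    intro u hu
    have hle : (hψ.form dV hW u u).re ≤ Real.exp (k * C) * (hφ.form dV hW u u).re :=
      re_l2Inner_self_le dV h (hφ.integrable_pairing dV (hW u.2) (hW u.2))
        (hψ.integrable_pairing dV (hW u.2) (hW u.2))
    refine pos_of_mul_pos_right (lt_of_lt_of_le ?_ hle) (Real.exp_pos _).le
    obtain ⟨c, rfl⟩ := (Submodule.mem_span_range_iff_exists_fun ℂ).mp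
      (hspan.symm ▸ Submodule.mem_top : u ∈ Submodule.span ℂ (Set.range t'))
    rw [form_sum_smul_self _ ht']
    obtain ⟨i, hi⟩ : ∃ i, c i ≠ 0 := by
      by_contra! h0
      exact hu (by simp [h0])
    exact Finset.sum_pos' (fun j _ => by positivity) ⟨i, Finset.mem_univ i, by positivity⟩
  obtain ⟨m', s, hs, hs_span⟩ := exists_orthonormal_spanning (hφ.form dV hW)
    (fun u v => φ.conj_l2Inner dV u.1 v.1) hpos
  refine ⟨m', fun i => (s i : PowSection L k), hs, ?_⟩
  have h1 := congrArg (Submodule.map W.subtype) hs_span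
  rwa [Submodule.map_span, ← Set.range_comp, Submodule.map_subtype_top] at h1

/-- Bergman kernels of two metrics with `φ ≤ ψ + C` satisfy the inequality with factor
`e^{kC}`. -/
theorem IsOrthonormalBasis.sum_norm_sq_powCoord_le {φ ψ : HermitianMetric L} (hφ : φ.IsSmooth n)
    (hψ : ψ.IsSmooth n) (hW : W ≤ holoSections L n k) {C : ℝ}
    (h : ∀ x, φ.weight (trivializationAt ℂ L x) x ≤ ψ.weight (trivializationAt ℂ L x) x + C)
    {m m' : ℕ} {s : Fin m → PowSection L k} {t : Fin m' → PowSection L k}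
    (hs : φ.IsOrthonormalBasis dV k W s) (ht : ψ.IsOrthonormalBasis dV k W t)
    (e : Trivialization ℂ (π ℂ L)) [MemTrivializationAtlas e] (x : X) :
    ∑ i, ‖powCoord e k x (s i x)‖ ^ 2 ≤
      Real.exp (k * C) * ∑ i, ‖powCoord e k x (t i x)‖ ^ 2 := by
  obtain ⟨s', hs_coe, hs', -⟩ := hs.exists_subtype dV hφ hW
  obtain ⟨t', ht_coe, ht', hspan⟩ := ht.exists_subtype dV hψ hW
  have hle : ∀ u : W, (hψ.form dV hW u u).re ≤ Real.exp (k * C) * (hφ.form dV hW u u).re :=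
    fun u => re_l2Inner_self_le dV h (hφ.integrable_pairing dV (hW u.2) (hW u.2))
      (hψ.integrable_pairing dV (hW u.2) (hW u.2))
  -- The linear form is evaluation at `x`, in the coordinate given by `e`.
  have key := sum_norm_sq_le_of_form_le _ _ hs' ht' hspan (Real.exp_pos _).le hle
    (powCoord e k x ∘ₗ LinearMap.proj x ∘ₗ W.subtype)
  simpa only [LinearMap.comp_apply, Submodule.subtype_apply, LinearMap.proj_apply, hs_coe, ht_coe]
    using key

/-- The bound `h` yields the inequality; `h'` ensures that `ψ` has an orthonormal basis whenever `φ`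
has one, so that the right side is not the default `-∞`. -/
theorem IsSmooth.bergman_weight_le {φ ψ : HermitianMetric L} (hφ : φ.IsSmooth n)
    (hψ : ψ.IsSmooth n) {k : ℕ+} {W : Submodule ℂ (PowSection L k)}
    (hW : W ≤ holoSections L n k) {C C' : ℝ}
    (h : ∀ x, φ.weight (trivializationAt ℂ L x) x ≤ ψ.weight (trivializationAt ℂ L x) x + C)
    (h' : ∀ x, ψ.weight (trivializationAt ℂ L x) x ≤ φ.weight (trivializationAt ℂ L x) x + C')
    (e : Trivialization ℂ (π ℂ L)) [MemTrivializationAtlas e] (x : X) :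
    (φ.bergman dV k W).weight e x ≤ (ψ.bergman dV k W).weight e x + (C : EReal) := by
  by_cases hb : ∃ (m : ℕ) (s : Fin m → PowSection L k), φ.IsOrthonormalBasis dV k W s
  · have hb' : ∃ (m : ℕ) (s : Fin m → PowSection L k), ψ.IsOrthonormalBasis dV k W s := by
      obtain ⟨m, s, hs⟩ := hb
      exact hs.exists_of_weight_le dV hψ hφ hW h'
    rw [bergman, bergman, dif_pos hb, dif_pos hb']
    exact SingularMetric.ofSections_weight_le e
      (IsOrthonormalBasis.sum_norm_sq_powCoord_le dV hφ hψ hW h hb.choose_spec.choose_spec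
        hb'.choose_spec.choose_spec e x)
  · rw [bergman, dif_neg hb]
    exact bot_le

theorem IsSmooth.filtrationMetric_moreSingular {φ ψ : HermitianMetric L} (hφ : φ.IsSmooth n)
    (hψ : ψ.IsSmooth n) (F : SectionFiltration L n) (lam : ℝ) :
    (φ.filtrationMetric dV F lam).MoreSingular (ψ.filtrationMetric dV F lam) := by
  obtain ⟨C, hC⟩ := hφ.exists_weight_le hψ
  obtain ⟨C', hC'⟩ := hψ.exists_weight_le hφ
  exact SingularMetric.MoreSingular.uscReg ⟨C, fun e _ x _ =>
    SingularMetric.limsup_weight_le e fun k =>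
      hφ.bergman_weight_le dV hψ (F.space_le _ _) hC hC' e x⟩

end Smooth

end HermitianMetric

end LineBundles

theorem lemma7p7 {n : ℕ} {X : Type*} [TopologicalSpace X] [T2Space X] [CompactSpace X]
    [ChartedSpace (Cn n) X] [IsManifold 𝓘(ℂ, Cn n) ω X] [MeasurableSpace X] [BorelSpace X]
    {L : X → Type*} [∀ x, AddCommGroup (L x)] [∀ x, Module ℂ (L x)] [∀ x, TopologicalSpace (L x)]
    [TopologicalSpace (TotalSpace ℂ L)] [FiberBundle ℂ L] [VectorBundle ℂ ℂ L]
    [ContMDiffVectorBundle ω ℂ L 𝓘(ℂ, Cn n)]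
    (dV : Measure X) [IsProbabilityMeasure dV] (hdV : IsSmoothVolume n dV)
    (F : SectionFiltration L n) (hFm : F.IsMultiplicative) (hFb : F.IsBounded)
    (φ ψ : HermitianMetric L) (hφ : φ ∈ positiveMetrics L n) (hψ : ψ ∈ positiveMetrics L n)
    (lam : ℝ) :
    (φ.filtrationMetric dV F lam).Equivalent (ψ.filtrationMetric dV F lam) :=
  ⟨hφ.1.filtrationMetric_moreSingular dV hψ.1 F lam,
    hψ.1.filtrationMetric_moreSingular dV hφ.1 F lam⟩
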